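/- Let $m\ge 2$ and let $H_1,\dots,H_m$ be independent random variables with values in $[0,1]$ (almost surely), each of mean $1/m$, such that $E[H_1^2+\dots+H_m^2]<1$ (given the other assumptions, this says exactly that the $H_i$ are not all Bernoulli, i.e. not all $\{0,1\}$-valued). For probability laws $\rho_1,\dots,\rho_m$ on $\mathbb R$ let $\rho_1\circ\dots\circ\rho_m$ denote the law of $H_1X_1+\dots+H_mX_m$, where the $X_i$ are independent of each other and of $(H_1,\dots,H_m)$ and $X_i$ has law $\rho_i$; put $S_m(\rho)=\rho\circ\dots\circ\rho$. For a plane $m$-ary tree $A$ define $\mu^{\circ_m A}$ recursively: it is $\mu$ if $A$ is a single leaf, and $\mu^{\circ_m A^1}\circ\dots\circ\mu^{\circ_m A^m}$ if the root of $A$ is a node with subtrees $A^1,\dots,A^m$. Let $\mathbb A_n$ be the family of $m$-ary trees with $n$ nodes, taking into account the order of appearance of the nodes: its members are the histories that start from a single leaf and $n$ times replace a leaf by a node with $m$ leaves (so $\mathbb A_n$ has $\prod_{k=0}^{n-1}((m-1)k+1)$ members). The extended Wild sum of a probability law $\mu$ on $\mathbb R$ is $$\mu_t=\sum_{n\ge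 0}e^{-t}\bigl(1-e^{-(m-1)t}\bigr)^n\frac{1}{(m-1)^n\,n!}\sum_{A\in\mathbb A_n}\mu^{\circ_m A},\qquad t\ge 0 .$$ **Theorem.** Suppose that $\mu$ has a finite second moment. Then there is exactly one probability law $\gamma$ on $\mathbb R$ with finite first moment, with the same mean as $\mu$, and with $S_m(\gamma)=\gamma$; this $\gamma$ has a finite second moment. Every $\mu_t$, $t\ge 0$, is a probability law, and $\mu_t$ converges weakly to $\gamma$ as $t\to\infty$, at the exponential rate $\eta=1-E[H_1^2+\dots+H_m^2]$: for every $f\in C_b^2(\mathbb R)$ (that is, $f$ is twice continuously differentiable and $f,f',f''$ are bounded) there is a constant $c$ such that $$\bigl|\langle\mu_t,f\rangle-\langle\gamma,f\rangle\bigr|\le c\,e^{-\eta t}\qquad\text{for all } t\ge 0 .$$ -/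

import Mathlib

open MeasureTheory ProbabilityTheory Filter Topology

/-- Plane `m`-ary trees: a node stands for an interaction and has `m` ordered branches. -/
inductive InteractionTree (m : ℕ) : Type where
  | leaf : InteractionTree m
  | node : (Fin m → InteractionTree m) → InteractionTree m

namespace InteractionTree

/-- All the trees obtained from a given tree by one more branching: each leaf in turn is replaced
by a node with `m` leaves. There is one entry per leaf of the given tree. -/
def grow {m : ℕ} : InteractionTree m → Multiset (InteractionTree m)
  | leaf => {node fun _ => leaf}
  | node c => ∑ i : Fin m, (grow (c i)).map fun s => node (Function.update c i s)

/-- The family of all `m`-ary trees with `n` nodes, taking into account the order of the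
branchings: a tree is listed once for each order in which its nodes can have appeared,
starting from a single leaf. It has `∏ k < n, ((m - 1) * k + 1)` entries. -/
def withNodes (m : ℕ) : ℕ → Multiset (InteractionTree m)
  | 0 => {leaf}
  | n + 1 => (withNodes m n).bind grow

end InteractionTree

section Interaction

variable {Ω : Type*} [MeasurableSpace Ω] {m : ℕ}

/-- The law of `H₁ X₁ + ⋯ + H_m X_m`, where the `X i` are independent, `X i` has law `ρ i`, and
`(X₁, …, X_m)` is independent of `(H₁, …, H_m)`. -/
noncomputable def interactionLaw (P : Measure Ω) (H : Fin m → Ω → ℝ)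
    (ρ : Fin m → Measure ℝ) : Measure ℝ :=
  (P.prod (Measure.pi ρ)).map fun p => ∑ i, H i p.1 * p.2 i

/-- The transformation `S_m`: the law of `H₁ X₁ + ⋯ + H_m X_m` with `X i` i.i.d. of law `μ`. -/
noncomputable def smoothing (P : Measure Ω) (H : Fin m → Ω → ℝ) (μ : Measure ℝ) : Measure ℝ :=
  interactionLaw P H fun _ => μ

/-- The law at the root of a tree when the law `μ` is placed on each leaf. At every node the
branches interact, with fresh independent copies of the weights `H`. -/
noncomputable def treeLaw (P : Measure Ω) (H : Fin m → Ω → ℝ) (μ : Measure ℝ) :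
    InteractionTree m → Measure ℝ
  | .leaf => μ
  | .node c => interactionLaw P H fun i => treeLaw P H μ (c i)

/-- The extended Wild sum
`μ_t = ∑ₙ e^{-t} (1 - e^{-(m-1)t})ⁿ / ((m-1)ⁿ n!) ∑_{A with n nodes} μ^{∘A}`. -/
noncomputable def wildSum (P : Measure Ω) (H : Fin m → Ω → ℝ) (μ : Measure ℝ) (t : ℝ) :
    Measure ℝ :=
  Measure.sum fun n : ℕ =>
    ENNReal.ofReal (Real.exp (-t) * (1 - Real.exp (-((m : ℝ) - 1) * t)) ^ n
        / (((m : ℝ) - 1) ^ n * (n.factorial : ℝ))) •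
      ((InteractionTree.withNodes m n).map (treeLaw P H μ)).sum

/-- `γ` is a probability law on `ℝ` with finite first moment, mean `a`, and `S_m(γ) = γ`. -/
structure IsFixedLawWithMean (P : Measure Ω) (H : Fin m → Ω → ℝ) (a : ℝ) (γ : Measure ℝ) :
    Prop where
  isProbabilityMeasure : IsProbabilityMeasure γ
  smoothing_eq : smoothing P H γ = γ
  integrable : Integrable (fun x : ℝ => x) γ
  mean_eq : ∫ x, x ∂γ = a

end Interaction

/-- The class `C_b²`: twice continuously differentiable functions which are bounded together
with their first two derivatives. -/
def IsCb2 (f : ℝ → ℝ) : Prop :=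
  ContDiff ℝ 2 f ∧ ∀ k : ℕ, k ≤ 2 → ∃ M : ℝ, ∀ x : ℝ, |iteratedDeriv k f x| ≤ M

/-!
The convergence is a contraction argument for a distance of Zolotarev type. A test function is a
bounded `f : ℝ → ℝ` whose derivative is bounded by `L` and Lipschitz with constant `M` (`IsTest`),
and `CloseLaws ε K ρ ρ'` says that the integrals of all test functions against `ρ` and `ρ'` differ
by at most `ε L + K M`. If `f` has the constants `L`, `M`, then `x ↦ f (h x + y)` has the constants
`|h| L`, `h² M`. Replacing the variables of `H₁ X₁ + ⋯ + H_m X_m` one at a time therefore shows that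
an interaction turns closeness `(ε i, K i)` of the branches into closeness
`(∑ E[H i] ε i, ∑ E[H i ^ 2] K i)` (`CloseLaws.interactionLaw`). Here `∑ E[H i] = 1`, and
`q = ∑ E[H i ^ 2] < 1`, so that the smoothing transformation preserves `ε` and multiplies `K`
by `q`.

* Uniqueness. Two laws with finite first moments and the same mean are close with `ε` as small as
  one likes (`exists_closeLaws_of_integrable`). For fixed laws, `K` can be replaced by `q ^ n K`, so
  their integrals of a test function differ by at most `ε L`, for every `ε > 0`.
* Existence. The iterates of a point mass at the prescribed mean form a Cauchy sequence for the
  distance of order two (`ε = 0`). That distance controls the second moment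
  (`CloseLaws.lintegral_sq_le`) and determines the mean (`CloseLaws.integral_id_eq`), so the sequence
  is tight, and a weak limit point, given by Prokhorov's theorem, is the fixed law.
* Rate. A fixed law `γ` is also the law at the root of every tree with `γ` on its leaves. Hence the
  law at the root of a tree `A` with `μ` on its leaves is at distance at most `K w(A)` from `γ`, where
  `w(A)` is the sum over the leaves of the products of the `E[H i ^ 2]` along the path from the root
  (`IsContractingWeights.closeLaws_treeLaw`). Growing a leaf multiplies its weight by `q`, and a tree
  with `n` nodes has `(m - 1) n + 1` leaves, so the weights of all the trees with `n` nodes add up to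
  `∏ k < n, ((m - 1) k + q)` (`InteractionTree.sum_weight_withNodes`). Summed against the Wild
  coefficients, this is a binomial series with the value `e ^ (-(1 - q) t)`
  (`hasSum_wildCoeff_mul_prod`); the same series at `q = 1` shows that the Wild sum has mass `1`.
-/

/-! ### Test functions -/

/-- The bounded differentiable functions `f : ℝ → ℝ` whose derivative is bounded by `L` and is
Lipschitz with constant `M`. -/
structure IsTest (L M : ℝ) (f : ℝ → ℝ) : Prop where
  bdd : ∃ B, ∀ x, |f x| ≤ B
  exists_deriv : ∃ f' : ℝ → ℝ, (∀ x, HasDerivAt f (f' x) x) ∧ (∀ x, |f' x| ≤ L) ∧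
    ∀ x y, |f' x - f' y| ≤ M * |x - y|

namespace IsTest

variable {L M : ℝ} {f : ℝ → ℝ}

lemma continuous (hf : IsTest L M f) : Continuous f := by
  obtain ⟨f', h, -⟩ := hf.exists_deriv
  exact continuous_iff_continuousAt.2 fun x => (h x).continuousAt

lemma fst_nonneg (hf : IsTest L M f) : 0 ≤ L := by
  obtain ⟨f', -, h, -⟩ := hf.exists_deriv
  exact (abs_nonneg _).trans (h 0)

lemma snd_nonneg (hf : IsTest L M f) : 0 ≤ M := by
  obtain ⟨f', -, -, h⟩ := hf.exists_deriv
  simpa using (abs_nonneg _).trans (h 1 0)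

lemma comp_affine (hf : IsTest L M f) (h y : ℝ) :
    IsTest (|h| * L) (h ^ 2 * M) fun x => f (h * x + y) := by
  obtain ⟨B, hB⟩ := hf.bdd
  obtain ⟨f', h1, h2, h3⟩ := hf.exists_deriv
  refine ⟨⟨B, fun x => hB _⟩, fun x => f' (h * x + y) * h, fun x => ?_, fun x => ?_,
    fun x z => ?_⟩
  · have : HasDerivAt (fun x => h * x + y) h x := by
      simpa using ((hasDerivAt_id x).const_mul h).add_const y
    exact (h1 _).comp x this
  · rw [abs_mul, mul_comm]
    exact mul_le_mul_of_nonneg_left (h2 _) (abs_nonneg _)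
  · have := h3 (h * x + y) (h * z + y)
    rw [show h * x + y - (h * z + y) = h * (x - z) by ring, abs_mul] at this
    rw [← sub_mul, abs_mul, ← sq_abs h]
    nlinarith [mul_le_mul_of_nonneg_right this (abs_nonneg h)]

lemma integrable (hf : IsTest L M f) (ρ : Measure ℝ) [IsFiniteMeasure ρ] : Integrable f ρ := by
  obtain ⟨B, hB⟩ := hf.bdd
  exact Integrable.of_bound hf.continuous.aestronglyMeasurable B (ae_of_all _ hB)

/-- Both members bound the remainder of the first order Taylor expansion at `0`. -/
lemma exists_taylor (hf : IsTest L M f) :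
    ∃ d, ∀ x, |f x - f 0 - d * x| ≤ 2 * L * |x| ∧ |f x - f 0 - d * x| ≤ M * x ^ 2 := by
  obtain ⟨f', h1, h2, h3⟩ := hf.exists_deriv
  -- the mean value theorem on the segment from `0` to `x`
  have key : ∀ x, ∃ c, |c| ≤ |x| ∧ f x - f 0 = f' c * x := by
    intro x
    rcases lt_trichotomy x 0 with hx | rfl | hx
    · obtain ⟨c, hc, e⟩ := exists_hasDerivAt_eq_slope f f' hx hf.continuous.continuousOn
        fun y _ => h1 y
      refine ⟨c, ?_, ?_⟩
      · rw [abs_of_neg hc.2, abs_of_neg hx]; linarith [hc.1]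
      · rw [e]; field_simp; ring
    · exact ⟨0, by simp, by simp⟩
    · obtain ⟨c, hc, e⟩ := exists_hasDerivAt_eq_slope f f' hx hf.continuous.continuousOn
        fun y _ => h1 y
      refine ⟨c, ?_, ?_⟩
      · rw [abs_of_pos hc.1, abs_of_pos hx]; linarith [hc.2]
      · rw [e]; field_simp; ring
  refine ⟨f' 0, fun x => ?_⟩
  obtain ⟨c, hc, e⟩ := key x
  rw [e, ← sub_mul, abs_mul]
  constructor
  · gcongr
    calc |f' c - f' 0| ≤ |f' c| + |f' 0| := abs_sub _ _
      _ ≤ 2 * L := by linarith [h2 c, h2 0]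
  · calc |f' c - f' 0| * |x| ≤ (M * |x|) * |x| := by
          gcongr
          refine (h3 c 0).trans ?_
          rw [sub_zero]
          exact mul_le_mul_of_nonneg_left hc hf.snd_nonneg
      _ = M * x ^ 2 := by rw [← sq_abs x]; ring

lemma sin (l : ℝ) : IsTest |l| (l ^ 2) fun x => Real.sin (l * x) := by
  have : IsTest 1 1 Real.sin := by
    refine ⟨⟨1, Real.abs_sin_le_one⟩, Real.cos, Real.hasDerivAt_sin, Real.abs_cos_le_one, ?_⟩
    intro x y
    simpa using Convex.norm_image_sub_le_of_norm_deriv_le (f := Real.cos) (C := 1) (s := Set.univ)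
      (fun x _ => Real.differentiableAt_cos) (fun x _ => by
        simpa using Real.abs_sin_le_one x) convex_univ (Set.mem_univ y) (Set.mem_univ x)
  simpa using this.comp_affine l 0

lemma cos (l : ℝ) : IsTest |l| (l ^ 2) fun x => Real.cos (l * x) := by
  have : IsTest 1 1 fun x => Real.sin (1 * x) := by simpa using IsTest.sin 1
  have := this.comp_affine l (Real.pi / 2)
  simpa [Real.sin_add_pi_div_two] using this

end IsTest

/-- A function of class `C_b²` is a test function. -/
lemma IsCb2.exists_isTest {f : ℝ → ℝ} (hf : IsCb2 f) : ∃ L M, IsTest L M f := by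
  obtain ⟨hc, hb⟩ := hf
  obtain ⟨B, hB⟩ := hb 0 (by norm_num)
  obtain ⟨L, hL⟩ := hb 1 (by norm_num)
  obtain ⟨M, hM⟩ := hb 2 (by norm_num)
  have hd : Differentiable ℝ f := hc.differentiable (by norm_num)
  have hd' : Differentiable ℝ (deriv f) := by
    have : ContDiff ℝ 1 (deriv f) := by
      rw [show (2 : WithTop ℕ∞) = 1 + 1 by norm_num] at hc
      exact (contDiff_succ_iff_deriv.1 hc).2.2
    exact this.differentiable (by norm_num)
  refine ⟨L, M, ⟨B, by simpa using hB⟩, deriv f, fun x => (hd x).hasDerivAt,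
    by simpa [iteratedDeriv_one] using hL, fun x y => ?_⟩
  have hM' : ∀ x, |deriv (deriv f) x| ≤ M := by
    intro x
    have := hM x
    rwa [show (2 : ℕ) = 1 + 1 from rfl, iteratedDeriv_succ, iteratedDeriv_one] at this
  simpa using Convex.norm_image_sub_le_of_norm_deriv_le (f := deriv f) (C := M) (s := Set.univ)
      (fun x _ => hd' x) (fun x _ => hM' x) convex_univ (Set.mem_univ y) (Set.mem_univ x)

/-! ### Closeness of laws -/

/-- The integrals of a test function with bounds `L` on the derivative and `M` on the Lipschitz
constant of the derivative differ by at most `ε L + K M`. With `ε = 0`, this says that a distance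
of Zolotarev type, of order two, is at most `K`. -/
def CloseLaws (ε K : ℝ) (ρ ρ' : Measure ℝ) : Prop :=
  ∀ L M f, IsTest L M f → |∫ x, f x ∂ρ - ∫ x, f x ∂ρ'| ≤ ε * L + K * M

namespace CloseLaws

lemma refl (ρ : Measure ℝ) : CloseLaws 0 0 ρ ρ := fun L M f _ => by simp

lemma symm {ε K : ℝ} {ρ ρ' : Measure ℝ} (h : CloseLaws ε K ρ ρ') : CloseLaws ε K ρ' ρ :=
  fun L M f hf => by rw [abs_sub_comm]; exact h L M f hf

lemma trans {ε K ε' K' : ℝ} {ρ ρ' ρ'' : Measure ℝ} (h : CloseLaws ε K ρ ρ')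
    (h' : CloseLaws ε' K' ρ' ρ'') : CloseLaws (ε + ε') (K + K') ρ ρ'' := fun L M f hf => by
  have := abs_sub_le (∫ x, f x ∂ρ) (∫ x, f x ∂ρ') (∫ x, f x ∂ρ'')
  linarith [h L M f hf, h' L M f hf]

lemma mono {ε K ε' K' : ℝ} {ρ ρ' : Measure ℝ} (h : CloseLaws ε K ρ ρ')
    (hε : ε ≤ ε') (hK : K ≤ K') : CloseLaws ε' K' ρ ρ' := fun L M f hf =>
  (h L M f hf).trans (add_le_add (mul_le_mul_of_nonneg_right hε hf.fst_nonneg)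
    (mul_le_mul_of_nonneg_right hK hf.snd_nonneg))

end CloseLaws

lemma charFun_eq_integral_cos_add_sin (ρ : Measure ℝ) [IsFiniteMeasure ρ] (l : ℝ) :
    charFun ρ l = ((∫ x, Real.cos (l * x) ∂ρ : ℝ) : ℂ)
      + ((∫ x, Real.sin (l * x) ∂ρ : ℝ) : ℂ) * Complex.I := by
  rw [charFun_apply_real]
  have h1 := (IsTest.cos l).integrable ρ
  have h2 := (IsTest.sin l).integrable ρ
  rw [← integral_complex_ofReal, ← integral_complex_ofReal, ← integral_mul_const,
    ← integral_add h1.ofReal (h2.ofReal.mul_const _)]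
  congr with x
  rw [← Complex.ofReal_mul, Complex.exp_mul_I]
  simp

lemma eq_of_forall_isTest {ρ ρ' : Measure ℝ} [IsFiniteMeasure ρ] [IsFiniteMeasure ρ']
    (h : ∀ L M f, IsTest L M f → ∫ x, f x ∂ρ = ∫ x, f x ∂ρ') : ρ = ρ' := by
  refine Measure.ext_of_charFun (funext fun l => ?_)
  rw [charFun_eq_integral_cos_add_sin, charFun_eq_integral_cos_add_sin, h _ _ _ (IsTest.cos l),
    h _ _ _ (IsTest.sin l)]

/-- The distance between two integrals with respect to a probability measure of functions that
differ by at most `C`. -/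
lemma abs_integral_sub_integral_le {α : Type*} [MeasurableSpace α] {ρ : Measure α}
    [IsProbabilityMeasure ρ] {f g : α → ℝ} (hf : Integrable f ρ) (hg : Integrable g ρ) {C : ℝ}
    (h : ∀ x, |f x - g x| ≤ C) : |∫ x, f x ∂ρ - ∫ x, g x ∂ρ| ≤ C := by
  rw [← integral_sub hf hg]
  simpa using norm_integral_le_of_norm_le_const (μ := ρ) (f := fun x => f x - g x) (ae_of_all _ h)

lemma integral_pi_succ {n : ℕ} (ρ : Fin (n + 1) → Measure ℝ) [∀ i, IsProbabilityMeasure (ρ i)]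
    (h : Fin (n + 1) → ℝ) (f : ℝ → ℝ) :
    ∫ x, f (∑ i, h i * x i) ∂Measure.pi ρ
      = ∫ p, f (h 0 * p.1 + ∑ i : Fin n, h i.succ * p.2 i)
          ∂((ρ 0).prod (Measure.pi fun i : Fin n => ρ i.succ)) := by
  have := (measurePreserving_piFinSuccAbove ρ 0).symm.integral_comp'
    (g := fun x => f (∑ i, h i * x i))
  rw [← this]
  simp [MeasurableEquiv.piFinSuccAbove, Fin.sum_univ_succ]

/-- The coordinates of a linear combination of independent variables are replaced one at a time. -/
lemma abs_integral_pi_sub_le {n : ℕ} (ρ ρ' : Fin n → Measure ℝ)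
    [∀ i, IsProbabilityMeasure (ρ i)] [∀ i, IsProbabilityMeasure (ρ' i)] (ε K h : Fin n → ℝ)
    (hρ : ∀ i, CloseLaws (ε i) (K i) (ρ i) (ρ' i)) {L M : ℝ} {f : ℝ → ℝ} (hf : IsTest L M f) :
    |∫ x, f (∑ i, h i * x i) ∂Measure.pi ρ - ∫ x, f (∑ i, h i * x i) ∂Measure.pi ρ'|
      ≤ ∑ i, (ε i * (|h i| * L) + K i * (h i ^ 2 * M)) := by
  induction n generalizing f with
  | zero => simp
  | succ n ih =>
    rw [integral_pi_succ, integral_pi_succ, Fin.sum_univ_succ]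
    set s : (Fin n → ℝ) → ℝ := fun y => ∑ i : Fin n, h i.succ * y i
    have hs : Continuous s := by fun_prop
    obtain ⟨B, hB⟩ := hf.bdd
    have hint : ∀ (a : Measure ℝ) (b : Measure (Fin n → ℝ)) [IsProbabilityMeasure a]
        [IsProbabilityMeasure b], Integrable (fun p : ℝ × (Fin n → ℝ) => f (h 0 * p.1 + s p.2))
        (a.prod b) := fun a b _ _ =>
      Integrable.of_bound (hf.continuous.comp (by fun_prop)).aestronglyMeasurable B
        (ae_of_all _ fun p => hB _)
    set b := Measure.pi fun i : Fin n => ρ i.succ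
    set b' := Measure.pi fun i : Fin n => ρ' i.succ
    have e1 : |∫ p, f (h 0 * p.1 + s p.2) ∂((ρ 0).prod b)
        - ∫ p, f (h 0 * p.1 + s p.2) ∂((ρ 0).prod b')|
        ≤ ∑ i : Fin n, (ε i.succ * (|h i.succ| * L) + K i.succ * (h i.succ ^ 2 * M)) := by
      rw [integral_prod _ (hint _ _), integral_prod _ (hint _ _)]
      refine abs_integral_sub_integral_le (hint _ _).integral_prod_left
        (hint _ _).integral_prod_left fun x => ?_
      have hf' : IsTest L M fun y => f (h 0 * x + y) := by
        simpa [add_comm] using hf.comp_affine 1 (h 0 * x)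
      exact ih (fun i => ρ i.succ) (fun i => ρ' i.succ) (fun i => ε i.succ) (fun i => K i.succ)
        (fun i => h i.succ) (fun i => hρ i.succ) hf'
    have e2 : |∫ p, f (h 0 * p.1 + s p.2) ∂((ρ 0).prod b')
        - ∫ p, f (h 0 * p.1 + s p.2) ∂((ρ' 0).prod b')|
        ≤ ε 0 * (|h 0| * L) + K 0 * (h 0 ^ 2 * M) := by
      rw [integral_prod_symm _ (hint _ _), integral_prod_symm _ (hint _ _)]
      exact abs_integral_sub_integral_le (hint _ _).integral_prod_right
        (hint _ _).integral_prod_right fun y => hρ 0 _ _ _ (hf.comp_affine (h 0) (s y))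
    exact (abs_sub_le _ _ _).trans (by linarith)

section Interaction

variable {Ω : Type*} [MeasurableSpace Ω] {m : ℕ} {P : Measure Ω} [IsProbabilityMeasure P]
  {H : Fin m → Ω → ℝ}

lemma measurable_interaction (hH : ∀ i, Measurable (H i)) :
    Measurable fun p : Ω × (Fin m → ℝ) => ∑ i, H i p.1 * p.2 i := by
  refine Finset.measurable_sum _ fun i _ => ?_
  exact ((hH i).comp measurable_fst).mul ((measurable_pi_apply i).comp measurable_snd)

lemma isProbabilityMeasure_interactionLaw (hH : ∀ i, Measurable (H i)) (ρ : Fin m → Measure ℝ)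
    [∀ i, IsProbabilityMeasure (ρ i)] : IsProbabilityMeasure (interactionLaw P H ρ) :=
  Measure.isProbabilityMeasure_map (measurable_interaction hH).aemeasurable

/-- For fixed weights `h i`, the first and second order terms of the replacement bound scale by
`h i` and `h i ^ 2`; these factors are then averaged over the weights. -/
lemma CloseLaws.interactionLaw (hH : ∀ i, Measurable (H i))
    (hmem : ∀ i, ∀ᵐ ω ∂P, H i ω ∈ Set.Icc (0 : ℝ) 1) {ρ ρ' : Fin m → Measure ℝ}
    [∀ i, IsProbabilityMeasure (ρ i)] [∀ i, IsProbabilityMeasure (ρ' i)] {ε K : Fin m → ℝ}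
    (hρ : ∀ i, CloseLaws (ε i) (K i) (ρ i) (ρ' i)) :
    CloseLaws (∑ i, (∫ ω, H i ω ∂P) * ε i) (∑ i, (∫ ω, H i ω ^ 2 ∂P) * K i)
      (interactionLaw P H ρ) (interactionLaw P H ρ') := by
  intro L M f hf
  obtain ⟨B, hB⟩ := hf.bdd
  have hint : ∀ (b : Measure (Fin m → ℝ)) [IsProbabilityMeasure b],
      Integrable (fun p : Ω × (Fin m → ℝ) => f (∑ i, H i p.1 * p.2 i)) (P.prod b) := fun b _ =>
    Integrable.of_bound
      (hf.continuous.measurable.comp (measurable_interaction hH)).aestronglyMeasurable B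
      (ae_of_all _ fun p => hB _)
  have hmap : ∀ (r : Fin m → Measure ℝ) [∀ i, IsProbabilityMeasure (r i)],
      ∫ x, f x ∂(_root_.interactionLaw P H r)
        = ∫ ω, ∫ x, f (∑ i, H i ω * x i) ∂Measure.pi r ∂P := by
    intro r _
    rw [_root_.interactionLaw, integral_map (measurable_interaction hH).aemeasurable
      hf.continuous.aestronglyMeasurable, integral_prod _ (hint _)]
  have i1 : ∀ i, Integrable (H i) P := fun i =>
    Integrable.of_bound (hH i).aestronglyMeasurable 1 ((hmem i).mono fun ω h => by
      rw [Real.norm_eq_abs, abs_of_nonneg h.1]; exact h.2)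
  have i2 : ∀ i, Integrable (fun ω => H i ω ^ 2) P := fun i =>
    Integrable.of_bound ((hH i).pow_const 2).aestronglyMeasurable 1 ((hmem i).mono fun ω h => by
      rw [Real.norm_eq_abs, abs_of_nonneg (sq_nonneg _)]; nlinarith [h.1, h.2])
  have i3 : ∀ i, Integrable (fun ω => ε i * (H i ω * L) + K i * (H i ω ^ 2 * M)) P := fun i =>
    (((i1 i).mul_const L).const_mul _).add (((i2 i).mul_const M).const_mul _)
  rw [hmap, hmap, ← integral_sub (hint _).integral_prod_left (hint _).integral_prod_left]
  calc |∫ ω, (∫ x, f (∑ i, H i ω * x i) ∂Measure.pi ρ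
          - ∫ x, f (∑ i, H i ω * x i) ∂Measure.pi ρ') ∂P|
      ≤ ∫ ω, ∑ i, (ε i * (H i ω * L) + K i * (H i ω ^ 2 * M)) ∂P := by
        rw [← Real.norm_eq_abs]
        refine norm_integral_le_of_norm_le (integrable_finsetSum _ fun i _ => i3 i) ?_
        filter_upwards [ae_all_iff.2 hmem] with ω hω
        refine (abs_integral_pi_sub_le ρ ρ' ε K (fun i => H i ω) hρ hf).trans_eq ?_
        exact Finset.sum_congr rfl fun i _ => by rw [abs_of_nonneg (hω i).1]
    _ = _ := by
        rw [integral_finsetSum _ fun i _ => i3 i, Finset.sum_mul, Finset.sum_mul,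
          ← Finset.sum_add_distrib]
        refine Finset.sum_congr rfl fun i _ => ?_
        rw [integral_add (((i1 i).mul_const L).const_mul _) (((i2 i).mul_const M).const_mul _),
          integral_const_mul, integral_const_mul, integral_mul_const, integral_mul_const]
        ring

end Interaction

/-! ### Laws with equal means are close, and conversely -/

/-- The remainder bound for the first order Taylor expansion of a test function, integrated. -/
lemma abs_integral_sub_affine_le {ρ : Measure ℝ} [IsProbabilityMeasure ρ]
    (h1 : Integrable (fun x : ℝ => x) ρ) {L M : ℝ} {f g : ℝ → ℝ} (hf : IsTest L M f)
    (hg : Integrable g ρ) {d : ℝ} (h : ∀ x, |f x - f 0 - d * x| ≤ g x) :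
    |∫ x, f x ∂ρ - (f 0 + d * ∫ x, x ∂ρ)| ≤ ∫ x, g x ∂ρ := by
  have e : ∫ x, f x ∂ρ - (f 0 + d * ∫ x, x ∂ρ) = ∫ x, (f x - f 0 - d * x) ∂ρ := by
    have h2 : Integrable (fun x => f x - f 0) ρ := (hf.integrable ρ).sub (integrable_const _)
    rw [integral_sub h2 (h1.const_mul d), integral_sub (hf.integrable ρ) (integrable_const _),
      integral_const_mul]
    simp
    ring
  rw [e, ← Real.norm_eq_abs]
  exact norm_integral_le_of_norm_le hg (ae_of_all _ h)

lemma integrable_id_of_integrable_sq {ρ : Measure ℝ} [IsFiniteMeasure ρ]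
    (h : Integrable (fun x : ℝ => x ^ 2) ρ) : Integrable (fun x : ℝ => x) ρ := by
  refine ((integrable_const (1 : ℝ)).add h).mono' aestronglyMeasurable_id (ae_of_all _ fun x => ?_)
  simp only [Real.norm_eq_abs, Pi.add_apply]
  nlinarith [sq_abs x, sq_nonneg (|x| - 1), sq_nonneg x]

lemma closeLaws_of_integrable_sq {ρ ρ' : Measure ℝ} [IsProbabilityMeasure ρ]
    [IsProbabilityMeasure ρ'] (h : Integrable (fun x : ℝ => x ^ 2) ρ)
    (h' : Integrable (fun x : ℝ => x ^ 2) ρ') (hm : ∫ x, x ∂ρ = ∫ x, x ∂ρ') :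
    CloseLaws 0 (∫ x, x ^ 2 ∂ρ + ∫ x, x ^ 2 ∂ρ') ρ ρ' := by
  intro L M f hf
  obtain ⟨d, hd⟩ := hf.exists_taylor
  have e := abs_integral_sub_affine_le (integrable_id_of_integrable_sq h) hf (h.const_mul M)
    fun x => (hd x).2
  have e' := abs_integral_sub_affine_le (integrable_id_of_integrable_sq h') hf (h'.const_mul M)
    fun x => (hd x).2
  rw [integral_const_mul] at e e'
  rw [← hm, abs_sub_comm] at e'
  exact (abs_sub_le _ _ _).trans (by linarith)

/-- Laws with finite first moments and equal means agree up to an error which is arbitrarily small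
to first order. -/
lemma exists_closeLaws_of_integrable {ρ ρ' : Measure ℝ} [IsProbabilityMeasure ρ]
    [IsProbabilityMeasure ρ'] (h : Integrable (fun x : ℝ => x) ρ)
    (h' : Integrable (fun x : ℝ => x) ρ') (hm : ∫ x, x ∂ρ = ∫ x, x ∂ρ') {ε : ℝ} (hε : 0 < ε) :
    ∃ K, CloseLaws ε K ρ ρ' := by
  -- the part of the first moment carried by the values outside `[-n, n]`, where the bound
  -- `2 L |x|` of the Taylor remainder is used; inside, it is `M x ^ 2 ≤ M n ^ 2`
  let t : ℕ → ℝ → ℝ := fun n => (Set.Icc (-(n : ℝ)) n)ᶜ.indicator fun x => |x|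
  have hti : ∀ (r : Measure ℝ), Integrable (fun x : ℝ => x) r → ∀ n, Integrable (t n) r :=
    fun r hr n => hr.abs.indicator measurableSet_Icc.compl
  have ht : ∀ (r : Measure ℝ), Integrable (fun x : ℝ => x) r →
      Tendsto (fun n => ∫ x, t n x ∂r) atTop (𝓝 0) := by
    intro r hr
    rw [← integral_zero ℝ ℝ (μ := r)]
    refine tendsto_integral_of_dominated_convergence (fun x => |x|)
      (fun n => (hti r hr n).aestronglyMeasurable) hr.abs
      (fun n => ae_of_all _ fun x => ?_) (ae_of_all _ fun x => ?_)
    · refine (norm_indicator_le_norm_self _ _).trans_eq ?_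
      simp
    · obtain ⟨N, hN⟩ := exists_nat_ge |x|
      refine tendsto_const_nhds.congr' ?_
      filter_upwards [eventually_ge_atTop N] with n hn
      refine (Set.indicator_of_notMem ?_ _).symm
      rw [Set.notMem_compl_iff]
      exact abs_le.1 (hN.trans (by exact_mod_cast hn))
  obtain ⟨n, hn, hn'⟩ := (((ht ρ h).eventually (gt_mem_nhds (by positivity : 0 < ε / 4))).and
    ((ht ρ' h').eventually (gt_mem_nhds (by positivity : 0 < ε / 4)))).exists
  refine ⟨2 * (n : ℝ) ^ 2, fun L M f hf => ?_⟩
  obtain ⟨d, hd⟩ := hf.exists_taylor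
  have hL := hf.fst_nonneg
  have hM := hf.snd_nonneg
  have hb : ∀ x, |f x - f 0 - d * x| ≤ 2 * L * t n x + M * (n : ℝ) ^ 2 := by
    intro x
    by_cases hx : x ∈ Set.Icc (-(n : ℝ)) n
    · have : t n x = 0 := Set.indicator_of_notMem (by rwa [Set.notMem_compl_iff]) _
      rw [this, mul_zero, zero_add]
      refine (hd x).2.trans (mul_le_mul_of_nonneg_left ?_ hM)
      exact sq_le_sq' hx.1 hx.2
    · have : t n x = |x| := Set.indicator_of_mem hx _
      rw [this]
      exact (hd x).1.trans (le_add_of_nonneg_right (by positivity))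
  have key : ∀ (r : Measure ℝ) [IsProbabilityMeasure r], Integrable (fun x : ℝ => x) r →
      ∫ x, t n x ∂r < ε / 4 →
      |∫ x, f x ∂r - (f 0 + d * ∫ x, x ∂r)| ≤ ε / 2 * L + (n : ℝ) ^ 2 * M := by
    intro r _ hr hlt
    refine (abs_integral_sub_affine_le hr hf
      (((hti r hr n).const_mul (2 * L)).add (integrable_const (M * (n : ℝ) ^ 2))) hb).trans ?_
    have : ∫ x, (2 * L * t n x + M * (n : ℝ) ^ 2) ∂r = 2 * L * ∫ x, t n x ∂r + M * (n : ℝ) ^ 2 := by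
      rw [integral_add ((hti r hr n).const_mul (2 * L)) (integrable_const _), integral_const_mul]
      simp
    simp only [Pi.add_apply]
    rw [this]
    nlinarith
  have e := key ρ h hn
  have e' := key ρ' h' hn'
  rw [← hm, abs_sub_comm] at e'
  exact (abs_sub_le _ _ _).trans (by linarith)

lemma tendsto_inv_mul_sin (x : ℝ) :
    Tendsto (fun n : ℕ => ((1 : ℝ) / (n + 1))⁻¹ * Real.sin (1 / ((n : ℝ) + 1) * x)) atTop
      (𝓝 x) := by
  have h : HasDerivAt (fun l => Real.sin (l * x)) x 0 := by
    simpa [Function.comp_def] using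
      (Real.hasDerivAt_sin (0 * x)).comp 0 ((hasDerivAt_id (0 : ℝ)).mul_const x)
  have h1 : Tendsto (fun n : ℕ => (1 : ℝ) / (n + 1)) atTop (𝓝[≠] 0) :=
    tendsto_nhdsWithin_iff.2 ⟨tendsto_one_div_add_atTop_nhds_zero_nat,
      Eventually.of_forall fun n => (Nat.one_div_pos_of_nat).ne'⟩
  simpa [Function.comp_def, slope_def_field, div_eq_inv_mul] using h.tendsto_slope.comp h1

lemma abs_inv_mul_sin_le {l : ℝ} (hl : 0 < l) (x : ℝ) : |l⁻¹ * Real.sin (l * x)| ≤ |x| := by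
  rw [abs_mul, abs_of_pos (inv_pos.2 hl), inv_mul_le_iff₀ hl, ← abs_of_pos hl, ← abs_mul,
    abs_of_pos hl]
  exact Real.abs_sin_le_abs

/-- Closeness of order two controls the second moment: test with `(sin (l x) / l) ^ 2`, which is
affine in `cos (2 l x)`, and let `l` tend to `0`. -/
lemma CloseLaws.lintegral_sq_le {K : ℝ} {ρ ρ' : Measure ℝ} [IsProbabilityMeasure ρ]
    [IsProbabilityMeasure ρ'] (h : CloseLaws 0 K ρ ρ') (h2 : Integrable (fun x : ℝ => x ^ 2) ρ) :
    ∫⁻ x, ENNReal.ofReal (x ^ 2) ∂ρ' ≤ ENNReal.ofReal (∫ x, x ^ 2 ∂ρ + 2 * K) := by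
  set g : ℕ → ℝ → ℝ := fun n x => (((1 : ℝ) / (n + 1))⁻¹ * Real.sin (1 / ((n : ℝ) + 1) * x)) ^ 2
  have hgc : ∀ n, Continuous (g n) := fun n => by fun_prop
  have hg : ∀ n x, g n x = 2⁻¹ * (((1 : ℝ) / (n + 1))⁻¹) ^ 2
      * (1 - Real.cos (2 * (1 / ((n : ℝ) + 1)) * x)) := by
    intro n x
    simp only [g]
    rw [mul_pow, Real.sin_sq_eq_half_sub, mul_assoc 2]
    ring
  have hgi : ∀ n (r : Measure ℝ) [IsProbabilityMeasure r], Integrable (g n) r := by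
    intro n r _
    simp_rw [funext (hg n)]
    exact ((integrable_const _).sub ((IsTest.cos _).integrable r)).const_mul _
  have hge : ∀ n (r : Measure ℝ) [IsProbabilityMeasure r], ∫ x, g n x ∂r
      = 2⁻¹ * (((1 : ℝ) / (n + 1))⁻¹) ^ 2
        * (1 - ∫ x, Real.cos (2 * (1 / ((n : ℝ) + 1)) * x) ∂r) := by
    intro n r _
    simp_rw [hg n]
    rw [integral_const_mul, integral_sub (integrable_const _) ((IsTest.cos _).integrable r)]
    simp
  have hgb : ∀ n, ∫ x, g n x ∂ρ' ≤ ∫ x, x ^ 2 ∂ρ + 2 * K := by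
    intro n
    have hl : 0 < (1 : ℝ) / (n + 1) := Nat.one_div_pos_of_nat
    have b1 : ∫ x, g n x ∂ρ ≤ ∫ x, x ^ 2 ∂ρ :=
      integral_mono (hgi n ρ) h2 fun x => sq_le_sq.2 (abs_inv_mul_sin_le hl x)
    have b2 := (abs_le.1 (h _ _ _ (IsTest.cos (2 * ((1 : ℝ) / (n + 1)))))).2
    have b3 : ∫ x, g n x ∂ρ' - ∫ x, g n x ∂ρ ≤ 2 * K := by
      rw [hge, hge, ← mul_sub]
      calc _ ≤ 2⁻¹ * (((1 : ℝ) / (n + 1))⁻¹) ^ 2 * (K * (2 * (1 / ((n : ℝ) + 1))) ^ 2) := by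
            gcongr
            linarith
        _ = 2 * K := by field_simp
    linarith
  calc ∫⁻ x, ENNReal.ofReal (x ^ 2) ∂ρ'
      = ∫⁻ x, liminf (fun n => ENNReal.ofReal (g n x)) atTop ∂ρ' := by
        congr with x
        refine (Tendsto.liminf_eq ?_).symm
        exact (ENNReal.continuous_ofReal.tendsto _).comp ((tendsto_inv_mul_sin x).pow 2)
    _ ≤ liminf (fun n => ∫⁻ x, ENNReal.ofReal (g n x) ∂ρ') atTop :=
        lintegral_liminf_le fun n => (hgc n).measurable.ennreal_ofReal
    _ ≤ _ := by
        refine (liminf_le_liminf (Eventually.of_forall fun n => ?_)).trans_eq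
          (liminf_const _)
        rw [← ofReal_integral_eq_lintegral_ofReal (hgi n ρ') (ae_of_all _ fun x => sq_nonneg _)]
        exact ENNReal.ofReal_le_ofReal (hgb n)

lemma CloseLaws.integrable_sq {K : ℝ} {ρ ρ' : Measure ℝ} [IsProbabilityMeasure ρ]
    [IsProbabilityMeasure ρ'] (h : CloseLaws 0 K ρ ρ') (h2 : Integrable (fun x : ℝ => x ^ 2) ρ) :
    Integrable (fun x : ℝ => x ^ 2) ρ' :=
  (lintegral_ofReal_ne_top_iff_integrable (by fun_prop) (ae_of_all _ fun x => sq_nonneg x)).1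
    ((h.lintegral_sq_le h2).trans_lt ENNReal.ofReal_lt_top).ne

/-- Laws at a finite distance of order two have the same mean: test with `sin (l x) / l` and let
`l` tend to `0`. -/
lemma CloseLaws.integral_id_eq {K : ℝ} {ρ ρ' : Measure ℝ} [IsProbabilityMeasure ρ]
    [IsProbabilityMeasure ρ'] (h : CloseLaws 0 K ρ ρ') (h1 : Integrable (fun x : ℝ => x) ρ)
    (h1' : Integrable (fun x : ℝ => x) ρ') : ∫ x, x ∂ρ = ∫ x, x ∂ρ' := by
  set g : ℕ → ℝ → ℝ := fun n x => ((1 : ℝ) / (n + 1))⁻¹ * Real.sin (1 / ((n : ℝ) + 1) * x)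
  have hgc : ∀ n, Continuous (g n) := fun n => by fun_prop
  have ht : ∀ (r : Measure ℝ), Integrable (fun x : ℝ => x) r →
      Tendsto (fun n => ∫ x, g n x ∂r) atTop (𝓝 (∫ x, x ∂r)) := fun r hr =>
    tendsto_integral_of_dominated_convergence (fun x => |x|)
      (fun n => (hgc n).aestronglyMeasurable) hr.abs
      (fun n => ae_of_all _ fun x => abs_inv_mul_sin_le Nat.one_div_pos_of_nat x)
      (ae_of_all _ fun x => tendsto_inv_mul_sin x)
  have hlim := ((ht ρ h1).sub (ht ρ' h1')).abs
  have h0 : Tendsto (fun n : ℕ => K * ((1 : ℝ) / (n + 1))) atTop (𝓝 (K * 0)) :=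
    tendsto_one_div_add_atTop_nhds_zero_nat.const_mul K
  rw [mul_zero] at h0
  have hle : ∀ n : ℕ, |∫ x, g n x ∂ρ - ∫ x, g n x ∂ρ'| ≤ K * ((1 : ℝ) / (n + 1)) := by
    intro n
    have hl : 0 < (1 : ℝ) / (n + 1) := Nat.one_div_pos_of_nat
    have := h _ _ _ (IsTest.sin ((1 : ℝ) / (n + 1)))
    simp only [g]
    rw [integral_const_mul, integral_const_mul, ← mul_sub, abs_mul, abs_of_pos (inv_pos.2 hl),
      inv_mul_le_iff₀ hl]
    linarith
  have := le_of_tendsto_of_tendsto' hlim h0 hle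
  exact sub_eq_zero.1 (abs_nonpos_iff.1 this)

/-- Laws on `ℝ` with uniformly bounded second moments are tight. -/
lemma isTightMeasureSet_of_lintegral_sq_le {S : Set (Measure ℝ)} {D : ℝ}
    (h : ∀ ρ ∈ S, ∫⁻ x, ENNReal.ofReal (x ^ 2) ∂ρ ≤ ENNReal.ofReal D) : IsTightMeasureSet S := by
  rw [isTightMeasureSet_iff_exists_isCompact_measure_compl_le]
  intro ε hε
  have h0 : Tendsto (fun n : ℕ => ENNReal.ofReal (D / (n : ℝ) ^ 2)) atTop (𝓝 0) := by
    rw [← ENNReal.ofReal_zero]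
    refine (ENNReal.continuous_ofReal.tendsto _).comp (tendsto_const_nhds.div_atTop ?_)
    exact (tendsto_pow_atTop two_ne_zero).comp tendsto_natCast_atTop_atTop
  obtain ⟨n, hn, hn0⟩ := ((h0.eventually (gt_mem_nhds hε)).and (eventually_gt_atTop 0)).exists
  have hn2 : (0 : ℝ) < (n : ℝ) ^ 2 := by positivity
  refine ⟨Metric.closedBall 0 n, isCompact_closedBall _ _, fun ρ hρ => le_trans ?_ hn.le⟩
  have hsub : (Metric.closedBall (0 : ℝ) n)ᶜ
      ⊆ {x | ENNReal.ofReal ((n : ℝ) ^ 2) ≤ ENNReal.ofReal (x ^ 2)} := by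
    intro x hx
    rw [Set.mem_compl_iff, mem_closedBall_zero_iff, not_le] at hx
    refine ENNReal.ofReal_le_ofReal (sq_le_sq.2 ?_)
    rw [Nat.abs_cast]
    exact hx.le
  refine (measure_mono hsub).trans ?_
  rw [ENNReal.ofReal_div_of_pos hn2]
  refine (meas_ge_le_lintegral_div (by fun_prop) (by simpa using hn2.ne')
    ENNReal.ofReal_ne_top).trans ?_
  exact ENNReal.div_le_div_right (h ρ hρ) _

/-! ### The fixed law of the smoothing transformation -/

section FixedLaw

variable {Ω : Type*} [MeasurableSpace Ω] {m : ℕ} {P : Measure Ω}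
  {H : Fin m → Ω → ℝ}

/-- The standing assumptions on the weights that the contraction uses: they are `[0, 1]`-valued,
their means add up to `1`, and their second moments add up to `q < 1`. -/
structure IsContractingWeights (P : Measure Ω) (H : Fin m → Ω → ℝ) (q : ℝ) : Prop where
  measurable : ∀ i, Measurable (H i)
  mem_Icc : ∀ i, ∀ᵐ ω ∂P, H i ω ∈ Set.Icc (0 : ℝ) 1
  sum_integral : ∑ i, ∫ ω, H i ω ∂P = 1
  sum_integral_sq : ∑ i, ∫ ω, H i ω ^ 2 ∂P = q
  lt_one : q < 1

namespace IsContractingWeights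

variable {q : ℝ}

lemma nonneg (hH : IsContractingWeights P H q) : 0 ≤ q := by
  rw [← hH.sum_integral_sq]
  exact Finset.sum_nonneg fun i _ => integral_nonneg fun ω => sq_nonneg _

lemma smoothing_dirac (hH : IsContractingWeights P H q) (a : ℝ) :
    smoothing P H (Measure.dirac a) = P.map fun ω => ∑ i, H i ω * a := by
  have hae : (fun p : Ω × (Fin m → ℝ) => ∑ i, H i p.1 * p.2 i)
      =ᵐ[P.prod (Measure.pi fun _ => Measure.dirac a)] (fun ω => ∑ i, H i ω * a) ∘ Prod.fst := by
    have h1 : ∀ i : Fin m, ∀ᵐ x ∂Measure.pi (fun _ : Fin m => Measure.dirac a), x i = a := fun i =>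
      (measurePreserving_eval (fun _ : Fin m => Measure.dirac a) i).quasiMeasurePreserving.ae
        (p := fun y => y = a) (by rw [ae_dirac_eq]; rfl)
    filter_upwards [Measure.quasiMeasurePreserving_snd.ae (ae_all_iff.2 h1)] with p hp
    simp [hp]
  have hm : Measurable fun ω => ∑ i, H i ω * a :=
    Finset.measurable_sum _ fun i _ => (hH.measurable i).mul_const a
  rw [smoothing, interactionLaw, Measure.map_congr hae, ← Measure.map_map hm measurable_fst,
    Measure.map_fst_prod]
  simp

variable [IsProbabilityMeasure P]

lemma isProbabilityMeasure_smoothing (hH : IsContractingWeights P H q) (ρ : Measure ℝ)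
    [IsProbabilityMeasure ρ] : IsProbabilityMeasure (smoothing P H ρ) :=
  isProbabilityMeasure_interactionLaw hH.measurable _

lemma closeLaws_smoothing (hH : IsContractingWeights P H q) {ρ ρ' : Measure ℝ}
    [IsProbabilityMeasure ρ] [IsProbabilityMeasure ρ'] {ε K : ℝ} (h : CloseLaws ε K ρ ρ') :
    CloseLaws ε (q * K) (smoothing P H ρ) (smoothing P H ρ') := by
  have := CloseLaws.interactionLaw hH.measurable hH.mem_Icc (ρ := fun _ => ρ) (ρ' := fun _ => ρ')
    fun _ => h
  rwa [← Finset.sum_mul, ← Finset.sum_mul, hH.sum_integral, hH.sum_integral_sq, one_mul] at this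

/-- Among the laws with finite first moment, a fixed law is determined by its mean: closeness
`ε L + K M` of two fixed laws improves to `ε L + q ^ n K M` for all `n`, with `ε` arbitrary. -/
lemma eq_of_isFixedLawWithMean (hH : IsContractingWeights P H q) {a : ℝ} {γ γ' : Measure ℝ}
    (h : IsFixedLawWithMean P H a γ) (h' : IsFixedLawWithMean P H a γ') : γ = γ' := by
  have := h.isProbabilityMeasure
  have := h'.isProbabilityMeasure
  refine eq_of_forall_isTest fun L M f hf => ?_
  have hε : ∀ ε > 0, |∫ x, f x ∂γ - ∫ x, f x ∂γ'| ≤ ε * L := by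
    intro ε hε
    obtain ⟨K, hK⟩ := exists_closeLaws_of_integrable h.integrable h'.integrable
      (h.mean_eq.trans h'.mean_eq.symm) hε
    have hn : ∀ n : ℕ, CloseLaws ε (q ^ n * K) γ γ' := by
      intro n
      induction n with
      | zero => simpa using hK
      | succ n ih =>
        have := hH.closeLaws_smoothing ih
        rwa [h.smoothing_eq, h'.smoothing_eq, ← mul_assoc, ← pow_succ'] at this
    have hlim : Tendsto (fun n : ℕ => ε * L + q ^ n * K * M) atTop (𝓝 (ε * L + 0 * K * M)) :=
      (((tendsto_pow_atTop_nhds_zero_of_lt_one hH.nonneg hH.lt_one).mul_const K).mul_const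
        M).const_add _
    simpa using ge_of_tendsto' hlim fun n => hn n L M f hf
  have hlim : Tendsto (fun n : ℕ => (1 : ℝ) / (n + 1) * L) atTop (𝓝 (0 * L)) :=
    tendsto_one_div_add_atTop_nhds_zero_nat.mul_const L
  rw [zero_mul] at hlim
  exact sub_eq_zero.1 (abs_nonpos_iff.1
    (ge_of_tendsto' hlim fun n => hε _ Nat.one_div_pos_of_nat))

lemma integrable (hH : IsContractingWeights P H q) (i : Fin m) : Integrable (H i) P :=
  Integrable.of_bound (hH.measurable i).aestronglyMeasurable 1 ((hH.mem_Icc i).mono fun ω h => by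
    rw [Real.norm_eq_abs, abs_of_nonneg h.1]; exact h.2)

lemma exists_closeLaws_dirac (hH : IsContractingWeights P H q) (a : ℝ) :
    ∃ K, CloseLaws 0 K (Measure.dirac a) (smoothing P H (Measure.dirac a)) := by
  have := hH.isProbabilityMeasure_smoothing (Measure.dirac a)
  have hm : Measurable fun ω => ∑ i, H i ω * a :=
    Finset.measurable_sum _ fun i _ => (hH.measurable i).mul_const a
  refine ⟨_, closeLaws_of_integrable_sq (integrable_dirac (by finiteness)) ?_ ?_⟩
  · rw [hH.smoothing_dirac, integrable_map_measure (by fun_prop) hm.aemeasurable]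
    refine Integrable.of_bound ((hm.pow_const 2).aestronglyMeasurable) ((m * |a|) ^ 2) ?_
    filter_upwards [ae_all_iff.2 hH.mem_Icc] with ω hω
    simp only [Function.comp_apply, norm_pow, Real.norm_eq_abs]
    gcongr
    refine (Finset.abs_sum_le_sum_abs _ _).trans ?_
    have : ∀ i ∈ Finset.univ, |H i ω * a| ≤ |a| := fun i _ => by
      rw [abs_mul, abs_of_nonneg (hω i).1]
      exact mul_le_of_le_one_left (abs_nonneg a) (hω i).2
    simpa using Finset.sum_le_card_nsmul _ _ _ this
  · rw [hH.smoothing_dirac, integral_map (f := fun x : ℝ => x) hm.aemeasurable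
        (by fun_prop),
      integral_finsetSum _ fun i _ => (hH.integrable i).mul_const a]
    simp_rw [integral_mul_const]
    rw [← Finset.sum_mul, hH.sum_integral]
    simp

/-- The iterates of `S_m` on a point mass form a Cauchy sequence for the distance of order two. They
are tight, and any weak limit point is a fixed law. -/
lemma exists_isFixedLawWithMean (hH : IsContractingWeights P H q) (a : ℝ) :
    ∃ γ : Measure ℝ, IsFixedLawWithMean P H a γ ∧ Integrable (fun x : ℝ => x ^ 2) γ := by
  obtain ⟨K, hK⟩ := hH.exists_closeLaws_dirac a
  set ν : ℕ → Measure ℝ := fun n => (smoothing P H)^[n] (Measure.dirac a)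
  have hsucc : ∀ n, ν (n + 1) = smoothing P H (ν n) := fun n => Function.iterate_succ_apply' _ _ _
  have hprob : ∀ n, IsProbabilityMeasure (ν n) := by
    intro n
    induction n with
    | zero => exact Measure.dirac.isProbabilityMeasure
    | succ n ih => rw [hsucc]; exact hH.isProbabilityMeasure_smoothing _
  have hq : 0 < 1 - q := sub_pos.2 hH.lt_one
  -- with `C = K / (1 - q)`, the distances `K q ^ n` of consecutive iterates telescope
  set C := K / (1 - q)
  have hKC : K = C - q * C := by simp only [C]; field_simp
  have hstep : ∀ n, CloseLaws 0 (C * q ^ n - C * q ^ (n + 1)) (ν n) (ν (n + 1)) := by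
    intro n
    induction n with
    | zero =>
      refine CloseLaws.mono hK le_rfl (hKC.trans_le (le_of_eq ?_))
      ring
    | succ n ih =>
      rw [hsucc n, hsucc (n + 1)]
      refine (hH.closeLaws_smoothing ih).mono le_rfl (le_of_eq ?_)
      ring
  have htel : ∀ n k, CloseLaws 0 (C * q ^ n - C * q ^ (n + k)) (ν n) (ν (n + k)) := by
    intro n k
    induction k with
    | zero => exact (CloseLaws.refl _).mono le_rfl (by simp)
    | succ k ih => exact (ih.trans (hstep (n + k))).mono (by simp) (le_of_eq (by ring_nf))
  have hC : 0 ≤ C := by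
    refine div_nonneg ?_ hq.le
    have := (abs_nonneg _).trans (hK _ _ _ (IsTest.sin 1))
    simpa using this
  have hcauchy : ∀ n j, n ≤ j → CloseLaws 0 (C * q ^ n) (ν n) (ν j) := by
    intro n j hj
    obtain ⟨k, rfl⟩ := Nat.exists_eq_add_of_le hj
    exact (htel n k).mono le_rfl (sub_le_self _ (mul_nonneg hC (pow_nonneg hH.nonneg _)))
  have hsq0 : Integrable (fun x : ℝ => x ^ 2) (ν 0) := integrable_dirac (by finiteness)
  have htight : IsTightMeasureSet (Set.range ν) := by
    refine isTightMeasureSet_of_lintegral_sq_le (D := ∫ x, x ^ 2 ∂ν 0 + 2 * (C * q ^ 0)) ?_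
    rintro ρ ⟨n, rfl⟩
    exact (hcauchy 0 n (Nat.zero_le n)).lintegral_sq_le hsq0
  set ν' : ℕ → ProbabilityMeasure ℝ := fun n => ⟨ν n, hprob n⟩
  have hcomp : IsCompact (closure (Set.range ν')) := by
    refine isCompact_closure_of_isTightMeasureSet (htight.subset ?_)
    rintro _ ⟨_, ⟨n, rfl⟩, rfl⟩
    exact ⟨n, rfl⟩
  have hmem : ((hyperfilter ℕ).map ν' : Filter (ProbabilityMeasure ℝ)) ≤ 𝓟 (Set.range ν') :=
    le_principal_iff.2 (Filter.mem_map.2 (Filter.univ_mem' fun n => Set.mem_range_self n))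
  -- a limit along an ultrafilter suffices, because all the later iterates are close to each other
  obtain ⟨γ, -, hγ⟩ := hcomp.ultrafilter_le_nhds ((hyperfilter ℕ).map ν')
    (hmem.trans (monotone_principal subset_closure))
  have hγ' : Tendsto ν' (hyperfilter ℕ) (𝓝 γ) := hγ
  rw [ProbabilityMeasure.tendsto_iff_forall_integral_tendsto] at hγ'
  have hclose : ∀ n, CloseLaws 0 (C * q ^ n) (ν n) γ := by
    intro n L M f hf
    obtain ⟨B, hB⟩ := hf.bdd
    have hlim := hγ' (BoundedContinuousFunction.ofNormedAddCommGroup f hf.continuous B hB)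
    refine le_of_tendsto (hlim.const_sub (∫ x, f x ∂ν n)).abs ?_
    filter_upwards [Nat.hyperfilter_le_atTop (eventually_ge_atTop n)] with j hj
    exact hcauchy n j hj L M f hf
  have := hH.isProbabilityMeasure_smoothing (γ : Measure ℝ)
  have hsq : Integrable (fun x : ℝ => x ^ 2) (γ : Measure ℝ) := (hclose 0).integrable_sq hsq0
  refine ⟨γ, ⟨inferInstance, ?_, integrable_id_of_integrable_sq hsq, ?_⟩, hsq⟩
  · refine eq_of_forall_isTest fun L M f hf => ?_
    have hle : ∀ n : ℕ, |∫ x, f x ∂smoothing P H (γ : Measure ℝ) - ∫ x, f x ∂(γ : Measure ℝ)|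
        ≤ 2 * (C * q ^ (n + 1)) * M := by
      intro n
      have h1 := hH.closeLaws_smoothing (hclose n)
      rw [← hsucc] at h1
      refine (h1.symm.trans (hclose (n + 1)) L M f hf).trans_eq ?_
      ring
    have hlim : Tendsto (fun n : ℕ => 2 * (C * q ^ (n + 1)) * M) atTop (𝓝 (2 * (C * 0) * M)) :=
      ((((tendsto_pow_atTop_nhds_zero_of_lt_one hH.nonneg hH.lt_one).comp
        (tendsto_add_atTop_nat 1)).const_mul C).const_mul 2).mul_const M
    rw [mul_zero, mul_zero, zero_mul] at hlim
    exact sub_eq_zero.1 (abs_nonpos_iff.1 (ge_of_tendsto' hlim hle))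
  · rw [← (hclose 0).integral_id_eq (integrable_id_of_integrable_sq hsq0)
      (integrable_id_of_integrable_sq hsq)]
    exact integral_dirac _ _

end IsContractingWeights

end FixedLaw

/-! ### Weights of trees and the binomial series -/

namespace InteractionTree

variable {m : ℕ}

/-- The total weight of the leaves of a tree, where a leaf has as weight the product of the `p i`
over the branches `i` that lead to it from the root. -/
def weight (p : Fin m → ℝ) : InteractionTree m → ℝ
  | leaf => 1
  | node c => ∑ i, p i * weight p (c i)

lemma card_grow_node (c : Fin m → InteractionTree m) :
    (grow (node c)).card = ∑ i, (grow (c i)).card := by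
  simp [grow]

lemma sum_apply_update {α M : Type*} [AddCommGroup M] (F : Fin m → α → M) (c : Fin m → α)
    (i : Fin m) (s : α) : ∑ j, F j (Function.update c i s j) = ∑ j, F j (c j) - F i (c i) + F i s := by
  rw [← Finset.add_sum_erase _ _ (Finset.mem_univ i),
    ← Finset.add_sum_erase _ (fun j => F j (c j)) (Finset.mem_univ i)]
  have : ∑ j ∈ Finset.univ.erase i, F j (Function.update c i s j)
      = ∑ j ∈ Finset.univ.erase i, F j (c j) :=
    Finset.sum_congr rfl fun j hj => by rw [Function.update_of_ne (Finset.ne_of_mem_erase hj)]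
  rw [this, Function.update_self]
  abel

/-- Each branching replaces one leaf by `m` leaves. -/
lemma card_grow_of_mem_grow {A : InteractionTree m} :
    ∀ B ∈ grow A, ((grow B).card : ℤ) = (grow A).card + (m - 1) := by
  induction A with
  | leaf =>
    intro B hB
    rw [grow, Multiset.mem_singleton] at hB
    rw [hB, card_grow_node]
    simp [grow]
  | node c ih =>
    intro B hB
    rw [grow, Multiset.mem_sum] at hB
    obtain ⟨i, -, hB⟩ := hB
    obtain ⟨s, hs, rfl⟩ := Multiset.mem_map.1 hB
    rw [card_grow_node, card_grow_node]
    push_cast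
    rw [sum_apply_update (fun _ t => ((grow t).card : ℤ)), ih i s hs]
    ring

lemma card_grow_of_mem_withNodes {n : ℕ} :
    ∀ A ∈ withNodes m n, ((grow A).card : ℤ) = (m - 1) * n + 1 := by
  induction n with
  | zero =>
    intro A hA
    rw [withNodes, Multiset.mem_singleton] at hA
    simp [hA, grow]
  | succ n ih =>
    intro A hA
    obtain ⟨B, hB, hAB⟩ := Multiset.mem_bind.1 hA
    rw [card_grow_of_mem_grow A hAB, ih B hB]
    push_cast
    ring

/-- Branching at a leaf multiplies its weight by `q = ∑ i, p i`, so the sum over all the leaves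
decreases `1 - q` times the weight of the tree. -/
lemma sum_weight_grow (p : Fin m → ℝ) (A : InteractionTree m) :
    ((grow A).map (weight p)).sum = ((grow A).card - (1 - ∑ i, p i)) * weight p A := by
  induction A with
  | leaf => simp [grow, weight]
  | node c ih =>
    have h : ∀ i, (((grow (c i)).map fun s => node (Function.update c i s)).map (weight p)).sum
        = (grow (c i)).card * weight p (node c) - (1 - ∑ i, p i) * (p i * weight p (c i)) := by
      intro i
      rw [Multiset.map_map]
      have : (weight p ∘ fun s => node (Function.update c i s))
          = fun s => (weight p (node c) - p i * weight p (c i)) + p i * weight p s := by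
        funext s
        exact sum_apply_update (fun j t => p j * weight p t) c i s
      rw [this, Multiset.sum_map_add, Multiset.map_const', Multiset.sum_replicate,
        Multiset.sum_map_mul_left, ih, nsmul_eq_mul]
      ring
    rw [card_grow_node, grow, ← Multiset.coe_mapAddMonoidHom, map_sum,
      ← Multiset.coe_sumAddMonoidHom, map_sum]
    simp only [Multiset.coe_mapAddMonoidHom, Multiset.coe_sumAddMonoidHom, h]
    rw [Finset.sum_sub_distrib, ← Finset.sum_mul, ← Finset.mul_sum]
    push_cast
    rw [weight]
    ring

lemma sum_weight_withNodes (p : Fin m → ℝ) (n : ℕ) :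
    ((withNodes m n).map (weight p)).sum
      = ∏ k ∈ Finset.range n, (((m : ℝ) - 1) * k + ∑ i, p i) := by
  induction n with
  | zero => simp [withNodes, weight]
  | succ n ih =>
    rw [withNodes, Multiset.map_bind, Multiset.sum_bind, Finset.prod_range_succ, ← ih,
      ← Multiset.sum_map_mul_right]
    refine congrArg _ (Multiset.map_congr rfl fun A hA => ?_)
    rw [sum_weight_grow]
    have : ((grow A).card : ℝ) = (m - 1) * n + 1 := by
      exact_mod_cast card_grow_of_mem_withNodes A hA
    rw [this]
    ring

lemma card_withNodes (n : ℕ) :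
    ((withNodes m n).card : ℝ) = ∏ k ∈ Finset.range n, (((m : ℝ) - 1) * k + 1) := by
  induction n with
  | zero => simp [withNodes]
  | succ n ih =>
    rw [withNodes, Multiset.card_bind, Finset.prod_range_succ, ← ih]
    rw [Nat.cast_multiset_sum, Multiset.map_map]
    have : (withNodes m n).map (Nat.cast ∘ Multiset.card ∘ grow)
        = (withNodes m n).map fun _ => ((m : ℝ) - 1) * n + 1 :=
      Multiset.map_congr rfl fun A hA => by
        simp only [Function.comp_apply]
        exact_mod_cast card_grow_of_mem_withNodes A hA
    rw [this, Multiset.map_const', Multiset.sum_replicate, nsmul_eq_mul]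

end InteractionTree

/-- The binomial series for `(1 - x) ^ (-s)`. -/
lemma hasSum_prod_div_factorial (s : ℝ) {x : ℝ} (hx : |x| < 1) :
    HasSum (fun n : ℕ => (∏ k ∈ Finset.range n, (s + k)) / n.factorial * x ^ n)
      ((1 - x) ^ (-s)) := by
  have h := (Real.one_div_one_sub_rpow_hasFPowerSeriesOnBall_zero s).hasSum (y := x)
    (by simpa [enorm_eq_nnnorm, ← NNReal.coe_lt_coe] using hx)
  simp only [zero_add, FormalMultilinearSeries.ofScalars_apply_eq, smul_eq_mul] at h
  rw [Real.rpow_neg (by linarith [(abs_lt.1 hx).2]), ← one_div]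
  suffices e : (fun n : ℕ => (∏ k ∈ Finset.range n, (s + k)) / n.factorial * x ^ n)
      = fun n : ℕ => Ring.choose (s + n - 1) n * x ^ n by rw [e]; exact h
  funext n
  congr 1
  symm
  rw [eq_div_iff (by positivity)]
  have e := Ring.factorial_nsmul_multichoose_eq_ascPochhammer s n
  rw [← Ring.multichoose_eq, mul_comm, ← nsmul_eq_mul, e,
    Polynomial.ascPochhammer_smeval_eq_eval]
  clear e
  induction n with
  | zero => simp
  | succ n ih => rw [ascPochhammer_succ_eval, Finset.prod_range_succ, ih]

/-- The coefficient in the Wild sum of the trees with `n` nodes. -/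
noncomputable def wildCoeff (m n : ℕ) (t : ℝ) : ℝ :=
  Real.exp (-t) * (1 - Real.exp (-((m : ℝ) - 1) * t)) ^ n
    / (((m : ℝ) - 1) ^ n * (n.factorial : ℝ))

lemma wildCoeff_nonneg {m : ℕ} (hm : 2 ≤ m) (n : ℕ) {t : ℝ} (ht : 0 ≤ t) : 0 ≤ wildCoeff m n t := by
  have hm1 : (0 : ℝ) < (m : ℝ) - 1 := by
    have : (2 : ℝ) ≤ m := by exact_mod_cast hm
    linarith
  have h2 : 0 ≤ 1 - Real.exp (-((m : ℝ) - 1) * t) :=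
    sub_nonneg.2 (Real.exp_le_one_iff.2 (by nlinarith))
  rw [wildCoeff]
  positivity

/-- The product over `k` is the total weight of the trees with `n` nodes when the weights of the
branches add up to `q`; for `q = 1` it is the number of these trees. -/
lemma hasSum_wildCoeff_mul_prod {m : ℕ} (hm : 2 ≤ m) (q : ℝ) {t : ℝ} (ht : 0 ≤ t) :
    HasSum (fun n : ℕ => wildCoeff m n t * ∏ k ∈ Finset.range n, (((m : ℝ) - 1) * k + q))
      (Real.exp (-(1 - q) * t)) := by
  have hm1 : (0 : ℝ) < (m : ℝ) - 1 := by
    have : (2 : ℝ) ≤ m := by exact_mod_cast hm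
    linarith
  have hx : |1 - Real.exp (-((m : ℝ) - 1) * t)| < 1 := by
    have h1 := Real.exp_pos (-((m : ℝ) - 1) * t)
    have h2 : Real.exp (-((m : ℝ) - 1) * t) ≤ 1 := Real.exp_le_one_iff.2 (by nlinarith)
    rw [abs_lt]
    constructor <;> linarith
  have h := (hasSum_prod_div_factorial (q / ((m : ℝ) - 1)) hx).mul_left (Real.exp (-t))
  rw [sub_sub_cancel, ← Real.exp_mul, ← Real.exp_add] at h
  have e1 : -t + -((m : ℝ) - 1) * t * -(q / ((m : ℝ) - 1)) = -(1 - q) * t := by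
    field_simp
    ring
  rw [e1] at h
  refine (congrArg (fun F : ℕ → ℝ => HasSum F _) (funext fun n => ?_)).mp h
  have : ∏ k ∈ Finset.range n, (((m : ℝ) - 1) * k + q)
      = ((m : ℝ) - 1) ^ n * ∏ k ∈ Finset.range n, (q / ((m : ℝ) - 1) + k) := by
    have e2 : ((m : ℝ) - 1) ^ n = ∏ _k ∈ Finset.range n, ((m : ℝ) - 1) := by simp
    rw [e2, ← Finset.prod_mul_distrib]
    exact Finset.prod_congr rfl fun k _ => by field_simp; ring
  rw [this, wildCoeff]
  field_simp

/-! ### The Wild sum -/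

section WildSum

lemma multiset_sum_apply_univ (s : Multiset (Measure ℝ)) (hs : ∀ ρ ∈ s, IsProbabilityMeasure ρ) :
    s.sum Set.univ = s.card := by
  induction s using Multiset.induction with
  | empty => simp
  | cons ρ s ih =>
    have := hs ρ (Multiset.mem_cons_self _ _)
    rw [Multiset.sum_cons, Measure.add_apply, ih fun r hr => hs r (Multiset.mem_cons_of_mem hr),
      measure_univ, Multiset.card_cons]
    push_cast
    ring

lemma integral_multiset_sum (s : Multiset (Measure ℝ)) (hs : ∀ ρ ∈ s, IsProbabilityMeasure ρ)
    {L M : ℝ} {f : ℝ → ℝ} (hf : IsTest L M f) :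
    ∫ x, f x ∂s.sum = (s.map fun ρ => ∫ x, f x ∂ρ).sum := by
  induction s using Multiset.induction with
  | empty => simp
  | cons ρ s ih =>
    have := hs ρ (Multiset.mem_cons_self _ _)
    have hs' : ∀ r ∈ s, IsProbabilityMeasure r := fun r hr => hs r (Multiset.mem_cons_of_mem hr)
    have : IsFiniteMeasure s.sum := ⟨by simp [multiset_sum_apply_univ s hs']⟩
    rw [Multiset.sum_cons, integral_add_measure (hf.integrable _) (hf.integrable _), ih hs',
      Multiset.map_cons, Multiset.sum_cons]

variable {Ω : Type*} [MeasurableSpace Ω] {m : ℕ} {P : Measure Ω} [IsProbabilityMeasure P]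
  {H : Fin m → Ω → ℝ} {q : ℝ}

namespace IsContractingWeights

lemma isProbabilityMeasure_treeLaw (hH : IsContractingWeights P H q) (μ : Measure ℝ)
    [IsProbabilityMeasure μ] (A : InteractionTree m) : IsProbabilityMeasure (treeLaw P H μ A) := by
  induction A with
  | leaf => rw [treeLaw]; infer_instance
  | node c ih => rw [treeLaw]; exact isProbabilityMeasure_interactionLaw hH.measurable _

/-- A fixed law is the law at the root of every tree that has it on its leaves. -/
lemma closeLaws_treeLaw (hH : IsContractingWeights P H q) {μ γ : Measure ℝ}
    [IsProbabilityMeasure μ] [IsProbabilityMeasure γ] (hγ : smoothing P H γ = γ) {K : ℝ}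
    (hK : CloseLaws 0 K μ γ) (A : InteractionTree m) :
    CloseLaws 0 (K * A.weight fun i => ∫ ω, H i ω ^ 2 ∂P) (treeLaw P H μ A) γ := by
  induction A with
  | leaf => simpa [treeLaw, InteractionTree.weight] using hK
  | node c ih =>
    have := fun A => hH.isProbabilityMeasure_treeLaw μ A
    have h := CloseLaws.interactionLaw hH.measurable hH.mem_Icc (ρ := fun i => treeLaw P H μ (c i))
      (ρ' := fun _ => γ) ih
    rw [show interactionLaw P H (fun _ => γ) = γ from hγ] at h
    refine h.mono (by simp) (le_of_eq ?_)
    rw [InteractionTree.weight, Finset.mul_sum]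
    exact Finset.sum_congr rfl fun i _ => by ring

lemma isProbabilityMeasure_wildSum (hH : IsContractingWeights P H q) (hm : 2 ≤ m) (μ : Measure ℝ)
    [IsProbabilityMeasure μ] {t : ℝ} (ht : 0 ≤ t) : IsProbabilityMeasure (wildSum P H μ t) := by
  refine ⟨?_⟩
  have hs : ∀ n, ∀ ρ ∈ (InteractionTree.withNodes m n).map (treeLaw P H μ),
      IsProbabilityMeasure ρ := by
    intro n ρ hρ
    obtain ⟨A, -, rfl⟩ := Multiset.mem_map.1 hρ
    exact hH.isProbabilityMeasure_treeLaw μ A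
  have hsum := hasSum_wildCoeff_mul_prod hm 1 ht
  rw [sub_self, neg_zero, zero_mul, Real.exp_zero] at hsum
  have hterm : ∀ n : ℕ, (ENNReal.ofReal (wildCoeff m n t) •
      ((InteractionTree.withNodes m n).map (treeLaw P H μ)).sum) Set.univ
      = ENNReal.ofReal (wildCoeff m n t * ∏ k ∈ Finset.range n, (((m : ℝ) - 1) * k + 1)) := by
    intro n
    rw [Measure.smul_apply, multiset_sum_apply_univ _ (hs n), Multiset.card_map, smul_eq_mul,
      ← InteractionTree.card_withNodes, ENNReal.ofReal_mul (wildCoeff_nonneg hm n ht),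
      ENNReal.ofReal_natCast]
  rw [wildSum, Measure.sum_apply _ MeasurableSet.univ]
  refine (tsum_congr hterm).trans ?_
  rw [← ENNReal.ofReal_tsum_of_nonneg _ hsum.summable]
  · exact (congrArg ENNReal.ofReal hsum.tsum_eq).trans ENNReal.ofReal_one
  · intro n
    rw [← InteractionTree.card_withNodes]
    exact mul_nonneg (wildCoeff_nonneg hm n ht) (Nat.cast_nonneg _)

/-- The rate `e ^ (-(1 - q) t)` is the sum of the Wild coefficients against the weights of the
trees. -/
lemma closeLaws_wildSum (hH : IsContractingWeights P H q) (hm : 2 ≤ m) {μ γ : Measure ℝ}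
    [IsProbabilityMeasure μ] [IsProbabilityMeasure γ] (hγ : smoothing P H γ = γ) {K : ℝ}
    (hK : CloseLaws 0 K μ γ) {t : ℝ} (ht : 0 ≤ t) :
    CloseLaws 0 (K * Real.exp (-(1 - q) * t)) (wildSum P H μ t) γ := by
  intro L M f hf
  have hprob := hH.isProbabilityMeasure_wildSum hm μ ht
  set w : InteractionTree m → ℝ := InteractionTree.weight fun i => ∫ ω, H i ω ^ 2 ∂P
  have h1 : HasSum (fun n => wildCoeff m n t *
      ((InteractionTree.withNodes m n).map fun A => ∫ x, f x ∂treeLaw P H μ A).sum)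
      (∫ x, f x ∂wildSum P H μ t) := by
    have hint : Integrable f (wildSum P H μ t) := hf.integrable _
    refine (congrArg (fun F : ℕ → ℝ => HasSum F _) (funext fun n => ?_)).mp
      (hasSum_integral_measure hint)
    rw [integral_smul_measure, integral_multiset_sum _ _ hf, Multiset.map_map, smul_eq_mul]
    · congr 1
      exact ENNReal.toReal_ofReal (wildCoeff_nonneg hm n ht)
    · intro ρ hρ
      obtain ⟨A, -, rfl⟩ := Multiset.mem_map.1 hρ
      exact hH.isProbabilityMeasure_treeLaw μ A
  have h2 : HasSum (fun n => wildCoeff m n t *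
      ((InteractionTree.withNodes m n).map fun _ => ∫ x, f x ∂γ).sum) (∫ x, f x ∂γ) := by
    have hsum := (hasSum_wildCoeff_mul_prod hm 1 ht).mul_right (∫ x, f x ∂γ)
    rw [sub_self, neg_zero, zero_mul, Real.exp_zero, one_mul] at hsum
    refine (congrArg (fun F : ℕ → ℝ => HasSum F _) (funext fun n => ?_)).mp hsum
    rw [Multiset.map_const', Multiset.sum_replicate, nsmul_eq_mul,
      InteractionTree.card_withNodes]
    ring
  have h3 : HasSum (fun n => wildCoeff m n t *
      ((InteractionTree.withNodes m n).map fun A => K * w A * M).sum)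
      (K * Real.exp (-(1 - q) * t) * M) := by
    have hsum := ((hasSum_wildCoeff_mul_prod hm q ht).mul_left K).mul_right M
    refine (congrArg (fun F : ℕ → ℝ => HasSum F _) (funext fun n => ?_)).mp hsum
    rw [Multiset.sum_map_mul_right, Multiset.sum_map_mul_left,
      InteractionTree.sum_weight_withNodes, hH.sum_integral_sq]
    ring
  have h12 := h1.sub h2
  rw [zero_mul, zero_add, ← h12.tsum_eq, ← h3.tsum_eq, ← Real.norm_eq_abs]
  refine tsum_of_norm_bounded (h3.summable.hasSum) fun n => ?_
  rw [← mul_sub, ← Multiset.sum_map_sub, norm_mul, Real.norm_eq_abs,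
    abs_of_nonneg (wildCoeff_nonneg hm n ht)]
  refine mul_le_mul_of_nonneg_left ?_ (wildCoeff_nonneg hm n ht)
  refine (Multiset.le_sum_of_subadditive (fun x : ℝ => ‖x‖) norm_zero.le norm_add_le _).trans ?_
  rw [Multiset.map_map]
  refine Multiset.sum_map_le_sum_map _ _ fun A _ => ?_
  simpa using hH.closeLaws_treeLaw hγ hK A L M f hf

end IsContractingWeights

end WildSum

/-- Convergence against test functions implies weak convergence, by Lévy's theorem. -/
lemma tendsto_integral_of_forall_isTest {ρ : ℝ → Measure ℝ} {γ : Measure ℝ}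
    [IsProbabilityMeasure γ] (hρ : ∀ t, 0 ≤ t → IsProbabilityMeasure (ρ t))
    (h : ∀ L M f, IsTest L M f → Tendsto (fun t => ∫ x, f x ∂ρ t) atTop (𝓝 (∫ x, f x ∂γ)))
    (g : BoundedContinuousFunction ℝ ℝ) :
    Tendsto (fun t => ∫ x, g x ∂ρ t) atTop (𝓝 (∫ x, g x ∂γ)) := by
  refine tendsto_of_seq_tendsto fun u hu => ?_
  -- `ρ t` is a probability measure for `t ≥ 0` only, so the times are truncated at `0`
  have hu' : Tendsto (fun n => max (u n) 0) atTop atTop :=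
    tendsto_atTop_mono (fun n => le_max_left _ _) hu
  set ν : ℕ → ProbabilityMeasure ℝ := fun n => ⟨ρ (max (u n) 0), hρ _ (le_max_right _ _)⟩
  set γ' : ProbabilityMeasure ℝ := ⟨γ, inferInstance⟩
  have hν : Tendsto ν atTop (𝓝 γ') := by
    rw [ProbabilityMeasure.tendsto_iff_tendsto_charFun]
    intro l
    simp_rw [charFun_eq_integral_cos_add_sin]
    have h1 := (h _ _ _ (IsTest.cos l)).comp hu'
    have h2 := (h _ _ _ (IsTest.sin l)).comp hu'
    exact ((Complex.continuous_ofReal.tendsto _).comp h1).add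
      (((Complex.continuous_ofReal.tendsto _).comp h2).mul_const _)
  refine ((ProbabilityMeasure.tendsto_iff_forall_integral_tendsto.1 hν) g).congr' ?_
  filter_upwards [hu.eventually_ge_atTop 0] with n hn
  simp [ν, max_eq_left hn]

theorem mainTheorem2 {Ω : Type*} [MeasurableSpace Ω] (P : Measure Ω) [IsProbabilityMeasure P]
    (m : ℕ) (hm : 2 ≤ m) (H : Fin m → Ω → ℝ)
    (hH_meas : ∀ i, Measurable (H i)) (hH_indep : iIndepFun H P)
    (hH_mem : ∀ i, ∀ᵐ ω ∂P, H i ω ∈ Set.Icc (0 : ℝ) 1)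
    (hH_mean : ∀ i, ∫ ω, H i ω ∂P = 1 / (m : ℝ))
    (hH_sq : ∫ ω, ∑ i, H i ω ^ 2 ∂P < 1)
    (μ : Measure ℝ) [IsProbabilityMeasure μ] (hμ : Integrable (fun x : ℝ => x ^ 2) μ) :
    (∃! γ : Measure ℝ, IsFixedLawWithMean P H (∫ x, x ∂μ) γ) ∧
    (∀ t : ℝ, 0 ≤ t → IsProbabilityMeasure (wildSum P H μ t)) ∧
    ∀ γ : Measure ℝ, IsFixedLawWithMean P H (∫ x, x ∂μ) γ →
      Integrable (fun x : ℝ => x ^ 2) γ ∧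
      (∀ g : BoundedContinuousFunction ℝ ℝ,
        Tendsto (fun t : ℝ => ∫ x, g x ∂(wildSum P H μ t)) atTop (𝓝 (∫ x, g x ∂γ))) ∧
      ∀ f : ℝ → ℝ, IsCb2 f → ∃ c : ℝ, ∀ t : ℝ, 0 ≤ t →
        |∫ x, f x ∂(wildSum P H μ t) - ∫ x, f x ∂γ|
          ≤ c * Real.exp (-(1 - ∫ ω, ∑ i, H i ω ^ 2 ∂P) * t) := by
  set q := ∫ ω, ∑ i, H i ω ^ 2 ∂P with hq
  have hsq : ∑ i, ∫ ω, H i ω ^ 2 ∂P = q := by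
    refine (integral_finsetSum _ fun i _ => ?_).symm
    refine Integrable.of_bound ((hH_meas i).pow_const 2).aestronglyMeasurable 1
      ((hH_mem i).mono fun ω h => ?_)
    rw [Real.norm_eq_abs, abs_of_nonneg (sq_nonneg _)]
    nlinarith [h.1, h.2]
  have hH : IsContractingWeights P H q := by
    refine ⟨hH_meas, hH_mem, ?_, hsq, hH_sq⟩
    have : (m : ℝ) ≠ 0 := by positivity
    simp [hH_mean, this]
  obtain ⟨γ, hγ, hγ2⟩ := hH.exists_isFixedLawWithMean (∫ x, x ∂μ)
  refine ⟨⟨γ, hγ, fun γ' hγ' => hH.eq_of_isFixedLawWithMean hγ' hγ⟩,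
    fun t ht => hH.isProbabilityMeasure_wildSum hm μ ht, fun γ' hγ' => ?_⟩
  obtain rfl := hH.eq_of_isFixedLawWithMean hγ' hγ
  have := hγ.isProbabilityMeasure
  have hclose := fun t (ht : 0 ≤ t) => hH.closeLaws_wildSum hm hγ.smoothing_eq
    (closeLaws_of_integrable_sq hμ hγ2 hγ.mean_eq.symm) ht
  set K := ∫ x, x ^ 2 ∂μ + ∫ x, x ^ 2 ∂γ'
  have hrate : ∀ L M f, IsTest L M f → ∀ t, 0 ≤ t →
      |∫ x, f x ∂(wildSum P H μ t) - ∫ x, f x ∂γ'| ≤ K * M * Real.exp (-(1 - q) * t) :=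
    fun L M f hf t ht => (hclose t ht L M f hf).trans_eq (by ring)
  refine ⟨hγ2, tendsto_integral_of_forall_isTest
    (fun t ht => hH.isProbabilityMeasure_wildSum hm μ ht) fun L M f hf => ?_, fun f hf => ?_⟩
  · have h0 : Tendsto (fun t => K * M * Real.exp (-(1 - q) * t)) atTop (𝓝 (K * M * 0)) := by
      refine (Real.tendsto_exp_atBot.comp ?_).const_mul _
      exact tendsto_id.const_mul_atTop_of_neg (by linarith)
    rw [mul_zero] at h0
    refine tendsto_iff_norm_sub_tendsto_zero.2 (squeeze_zero' ?_ ?_ h0)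
    · exact Eventually.of_forall fun t => norm_nonneg _
    · filter_upwards [eventually_ge_atTop 0] with t ht
      exact hrate L M f hf t ht
  · obtain ⟨L, M, hf'⟩ := hf.exists_isTest
    exact ⟨K * M, hrate L M f hf'⟩
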